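/- For $d\ge 0$ let $H_d=\mathrm{conv}\{p\in\{0,1\}^d : p_1+\cdots+p_d \text{ even}\}\subset\mathbb{R}^d$ be the (even) halfcube. For a polytope $P$ with vertex set $V(P)$, call a partial order $\preceq$ on $V(P)$ suitable if every nonempty face $F$ of $P$ has a unique $\preceq$-minimal vertex $v_F$. The pulling triangulation $\mathrm{Pull}_\preceq(P)$ is defined recursively: if $P$ is a simplex, then $\mathrm{Pull}_\preceq(P)=\{P\}$; otherwise \[ \mathrm{Pull}_\preceq(P)=\bigcup_{F}\{\mathrm{conv}(Q\cup\{v_P\}) : Q\in \mathrm{Pull}_\preceq(F)\}, \] where $F$ ranges over the facets of $P$ that do not contain $v_P$. \textbf{Theorem.} There is a function $t$ of $d$ alone such that $|\mathrm{Pull}_\preceq(H_d)|=t(d)$ for every $d$ and every suitable partial order $\preceq$ on $V(H_d)$. It satisfies $t(d)=1$ for $d\le 3$ and \[ t(d)=d\,t(d-1)+2^{d-1}-d\qquad\text{for } d\ge 4, \] and \[ t(d)=\sum_{l=3}^{d}\frac{d!}{l!}\left(2^{l-1}-l\right)\qquad\text{for } d\ge 3 . \] Moreover, for every $d\ge 3$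 and every suitable partial order $\preceq$, the simplices of $\mathrm{Pull}_\preceq(H_d)$ are in bijection with the pairs $(\tau,B)$, where $\tau$ is a partial permutation of $[d]=\{1,\dots,d\}$ (a possibly empty sequence of distinct elements of $[d]$) and $B\subseteq[d]$ is a set of odd cardinality, not a singleton, that contains no entry of $\tau$. -/

import Mathlib

/-- The even halfcube `H_d`: the convex hull in `ℝ^d` of all `0/1`-vectors with even coordinate
sum. -/
def halfcube (d : ℕ) : Set (Fin d → ℝ) :=
  convexHull ℝ {p | (∀ i, p i = 0 ∨ p i = 1) ∧ ∃ k : ℕ, ∑ i, p i = 2 * (k : ℝ)}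

/-- The dimension of a nonempty convex set: the dimension of its affine hull. -/
noncomputable def polyDim {d : ℕ} (P : Set (Fin d → ℝ)) : ℕ :=
  Module.finrank ℝ (vectorSpan ℝ P)

/-- `P` is a simplex: the convex hull of a nonempty finite affinely independent family. -/
def IsSimplex {d : ℕ} (P : Set (Fin d → ℝ)) : Prop :=
  ∃ (n : ℕ) (s : Affine.Simplex ℝ (Fin d → ℝ) n), P = convexHull ℝ (Set.range s.points)

/-- `F` is a nonempty face of `P`: the set of points of `P` at which some linear function attains
its maximum over `P` (the zero function gives `P` itself). -/
def IsFace {d : ℕ} (P F : Set (Fin d → ℝ)) : Prop :=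
  F.Nonempty ∧ IsExposed ℝ P F

/-- `F` is a facet of `P`: a nonempty face of codimension one. -/
def IsFacet {d : ℕ} (P F : Set (Fin d → ℝ)) : Prop :=
  IsFace P F ∧ polyDim F + 1 = polyDim P

/-- `v` is a minimal element, with respect to `r`, of the vertex set of `P`. -/
def IsMinVertex {d : ℕ} (r : (Fin d → ℝ) → (Fin d → ℝ) → Prop)
    (P : Set (Fin d → ℝ)) (v : Fin d → ℝ) : Prop :=
  v ∈ P.extremePoints ℝ ∧ ∀ w ∈ P.extremePoints ℝ, r w v → w = v

/-- `r` restricts to a partial order on the vertices of `P` for which (the vertex set of) every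
nonempty face of `P` has a unique minimal element. Only the values of `r` on vertices of `P`
matter. -/
structure IsPullingOrder {d : ℕ} (r : (Fin d → ℝ) → (Fin d → ℝ) → Prop)
    (P : Set (Fin d → ℝ)) : Prop where
  refl : ∀ u ∈ P.extremePoints ℝ, r u u
  antisymm : ∀ u ∈ P.extremePoints ℝ, ∀ v ∈ P.extremePoints ℝ, r u v → r v u → u = v
  trans : ∀ u ∈ P.extremePoints ℝ, ∀ v ∈ P.extremePoints ℝ, ∀ w ∈ P.extremePoints ℝ,
    r u v → r v w → r u w
  existsUnique_min : ∀ F, IsFace P F → ∃! v, IsMinVertex r F v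

/-- `IsPullSimplex r P Q`: `Q` is a member of the pulling triangulation of `P` with respect to `r`.
If `P` is a simplex, its only member is `P`. Otherwise its members are the joins
`v ∗ Q = conv (Q ∪ {v})`, where `v` is the minimal vertex of `P` and `Q` is a member of the
pulling triangulation of a facet of `P` that does not contain `v`. -/
inductive IsPullSimplex {d : ℕ} (r : (Fin d → ℝ) → (Fin d → ℝ) → Prop) :
    Set (Fin d → ℝ) → Set (Fin d → ℝ) → Prop
  | simplex {P : Set (Fin d → ℝ)} (hP : IsSimplex P) : IsPullSimplex r P P
  | join {P F Q : Set (Fin d → ℝ)} {v : Fin d → ℝ} (hP : ¬ IsSimplex P)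
      (hv : IsMinVertex r P v) (hF : IsFacet P F) (hvF : v ∉ F) (hQ : IsPullSimplex r F Q) :
      IsPullSimplex r P (convexHull ℝ (insert v Q))

/-- The pulling triangulation of `P` with respect to `r`, as the set of its simplices. -/
def pull {d : ℕ} (r : (Fin d → ℝ) → (Fin d → ℝ) → Prop) (P : Set (Fin d → ℝ)) :
    Set (Set (Fin d → ℝ)) :=
  {Q | IsPullSimplex r P Q}

/-- The recursion for a simplex. -/
theorem pull_of_isSimplex {d : ℕ} (r : (Fin d → ℝ) → (Fin d → ℝ) → Prop)
    (P : Set (Fin d → ℝ)) (hP : IsSimplex P) : pull r P = {P} := by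
  ext Q
  constructor
  · intro h
    cases h with
    | simplex _ => rfl
    | join h' => exact absurd hP h'
  · rintro rfl
    exact IsPullSimplex.simplex hP

/-- The recursion for a polytope that is not a simplex and whose unique minimal vertex is `v`. -/
theorem pull_of_not_isSimplex {d : ℕ} (r : (Fin d → ℝ) → (Fin d → ℝ) → Prop)
    (P : Set (Fin d → ℝ)) (v : Fin d → ℝ) (hP : ¬ IsSimplex P)
    (hv : ∀ w, IsMinVertex r P w ↔ w = v) :
    pull r P = ⋃ F ∈ {F | IsFacet P F ∧ v ∉ F},
      (fun Q => convexHull ℝ (insert v Q)) '' pull r F := by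
  ext R
  simp only [Set.mem_iUnion, Set.mem_image, Set.mem_ofPred_eq, exists_prop]
  constructor
  · intro h
    cases h with
    | simplex h' => exact absurd h' hP
    | @join _ F Q w _ hw hF hwF hQ =>
      obtain rfl := (hv w).1 hw
      exact ⟨F, ⟨hF, hwF⟩, Q, hQ, rfl⟩
  · rintro ⟨F, ⟨hF, hvF⟩, Q, hQ, rfl⟩
    exact IsPullSimplex.join hP ((hv v).2 rfl) hF hvF hQ

/-- The pairs `(τ, B)`: `τ` is a partial permutation of `[d]`, i.e. a (possibly empty) sequence of
distinct elements, and `B` is a subset of `[d] ∖ τ` of odd cardinality that is not a singleton. -/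
def admissiblePairs (d : ℕ) : Set (List (Fin d) × Finset (Fin d)) :=
  {x | x.1.Nodup ∧ (∀ i ∈ x.2, i ∉ x.1) ∧ Odd x.2.card ∧ x.2.card ≠ 1}

/-!
The proof treats all halfcubes of dimension at most `d` at once, as faces of `halfcube d`. A vertex
of the cube is encoded by its support, a `Finset (Fin d)`, and `subhalfcube S c` is the set of the
even vertices that agree with `c` outside the set `S` of free directions. For `3 ≤ S.card` its hull
has dimension `S.card`; for `S.card ≤ 3` it is a simplex, because vertices at pairwise Hamming
distance `2` are affinely independent (`affineIndependent_cubeVertex`); for `4 ≤ S.card` it has too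
many vertices to be a simplex.

The key step is the determination of the facets for `n = S.card ≥ 4` (`facet_subhalfcube`). Let
`a` be a linear function and `g` a vertex that maximizes it among the vertices of the cube with the
prescribed coordinates outside `S`. The value of `a` at another vertex `A` is smaller by the sum of
`|a i|` over the coordinates `i` in which `A` and `g` differ. If some coefficient in a free
direction vanishes, the even maximizers are those obtained from `g` by changes in the directions
with vanishing coefficient, so the face has dimension `n - 1` only if there are `n - 1` of these.
If no coefficient vanishes, the face is a single vertex for `g` even, and is spanned by some
neighbours of `g` for `g` odd, so it is a facet only if `g` is odd and all neighbours occur.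

Consequently the facets that avoid a vertex `v` are `n` subhalfcubes, one for each free direction,
and the simplices spanned by the neighbours of the `2 ^ (n - 1) - n` odd vertices not adjacent to
`v`; the choice of `v` does not affect these numbers. No simplex of the triangulation of a
subhalfcube is constant in a free direction, which makes the simplices arising from different
facets distinct (`exists_finset_pull_subhalfcube`). This gives the recursion `pairCount`.

Admissible pairs `(τ, B)` satisfy the same recursion: either `τ` is empty and `B` is one of the
`2 ^ (n - 1) - n` odd nonsingletons, or removing the first entry of `τ` from the ground set leaves
an admissible pair on `n - 1` elements. The bijection follows from the equality of the two
cardinalities.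
-/

/-! ### Parity and symmetric differences of finite sets -/

theorem Finset.even_card_symmDiff {α : Type*} [DecidableEq α] (A B : Finset α) :
    Even (symmDiff A B).card ↔ (Even A.card ↔ Even B.card) := by
  have h : (symmDiff A B).card + 2 * (A ∩ B).card = A.card + B.card := by
    have h1 := Finset.card_sdiff_add_card_inter A B
    have h2 := Finset.card_sdiff_add_card_inter B A
    have h3 : (symmDiff A B).card = (A \ B).card + (B \ A).card := by
      rw [symmDiff_def, Finset.sup_eq_union, Finset.card_union_of_disjoint disjoint_sdiff_sdiff]
    rw [Finset.inter_comm B A] at h2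
    omega
  grind

theorem Finset.symmDiff_subset_iff_mem {α : Type*} [DecidableEq α] {A B S : Finset α} :
    symmDiff A B ⊆ S ↔ ∀ i ∉ S, (i ∈ A ↔ i ∈ B) := by
  simp only [Finset.subset_iff, Finset.mem_symmDiff]
  grind

/-! ### Counting odd subsets and admissible pairs -/

/-- The subsets of `S` that have odd cardinality and are not singletons. -/
def oddNonsingletons {α : Type*} [DecidableEq α] (S : Finset α) : Finset (Finset α) :=
  S.powerset.filter fun B => Odd B.card ∧ B.card ≠ 1

theorem mem_oddNonsingletons {α : Type*} [DecidableEq α] {S B : Finset α} :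
    B ∈ oddNonsingletons S ↔ B ⊆ S ∧ Odd B.card ∧ B.card ≠ 1 := by
  simp [oddNonsingletons]

theorem card_oddNonsingletons {α : Type*} [DecidableEq α] {S : Finset α} (hS : S.Nonempty) :
    (oddNonsingletons S).card = 2 ^ (S.card - 1) - S.card := by
  have hodd : (S.powerset.filter fun B => Odd B.card).card = 2 ^ (S.card - 1) := by
    have h0 := Finset.sum_powerset_neg_one_pow_card_of_nonempty hS
    have h1 : ∀ B ∈ S.powerset, ((-1 : ℤ) ^ B.card) = 1 - 2 * (if Odd B.card then 1 else 0) := by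
      intro B _
      rcases Nat.even_or_odd B.card with h | h
      · simp [h.neg_one_pow, Nat.not_odd_iff_even.2 h]
      · simp [h.neg_one_pow, h]
    rw [Finset.sum_congr rfl h1, Finset.sum_sub_distrib, ← Finset.mul_sum, Finset.sum_boole] at h0
    simp only [Finset.sum_const, Finset.card_powerset, nsmul_eq_mul, mul_one] at h0
    have hpos := hS.card_pos
    obtain ⟨n, hn⟩ : ∃ n, S.card = n + 1 := ⟨S.card - 1, by omega⟩
    rw [hn, pow_succ] at h0
    rw [hn, Nat.add_sub_cancel]
    push_cast at h0
    zify
    linarith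
  have hsplit : (oddNonsingletons S) =
      (S.powerset.filter fun B => Odd B.card) \ S.powersetCard 1 := by
    ext B
    simp only [mem_oddNonsingletons, Finset.mem_sdiff, Finset.mem_filter, Finset.mem_powerset,
      Finset.mem_powersetCard]
    tauto
  rw [hsplit, Finset.card_sdiff_of_subset, hodd, Finset.card_powersetCard, Nat.choose_one_right]
  intro B
  simp only [Finset.mem_filter, Finset.mem_powerset, Finset.mem_powersetCard]
  rintro ⟨h, h'⟩
  exact ⟨h, by simp [h']⟩

/-- The number of pairs of a partial permutation of an `n`-set and an odd nonsingleton subset of the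
remaining elements, by the recursion that removes the first entry of the permutation. The
truncated subtraction is harmless since `n + 1 ≤ 2 ^ n`. -/
def pairCount : ℕ → ℕ
  | 0 => 0
  | n + 1 => (n + 1) * pairCount n + (2 ^ n - (n + 1))

/-- The admissible pairs supported in a subset `S` of the ground set. -/
def admissiblePairsIn {α : Type*} (S : Finset α) : Set (List α × Finset α) :=
  {x | x.1.Nodup ∧ (∀ i ∈ x.1, i ∈ S) ∧ x.2 ⊆ S ∧ (∀ i ∈ x.2, i ∉ x.1) ∧
    Odd x.2.card ∧ x.2.card ≠ 1}

theorem exists_finset_admissiblePairsIn {α : Type*} [DecidableEq α] (S : Finset α) :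
    ∃ T : Finset (List α × Finset α), (T : Set (List α × Finset α)) = admissiblePairsIn S ∧
      T.card = pairCount S.card := by
  induction hn : S.card generalizing S with
  | zero =>
    obtain rfl := Finset.card_eq_zero.1 hn
    refine ⟨∅, ?_, by simp [pairCount]⟩
    symm
    rw [Finset.coe_empty, Set.eq_empty_iff_forall_notMem]
    rintro ⟨τ, B⟩ ⟨-, -, h, -, h', -⟩
    obtain rfl := Finset.subset_empty.1 h
    simp at h'
  | succ n ih =>
    have key : ∀ i, ∃ T : Finset (List α × Finset α), i ∈ S →
        (T : Set (List α × Finset α)) = admissiblePairsIn (S.erase i) ∧ T.card = pairCount n := by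
      intro i
      by_cases hi : i ∈ S
      · obtain ⟨T, hT⟩ := ih (S.erase i) (by rw [Finset.card_erase_of_mem hi]; omega)
        exact ⟨T, fun _ => hT⟩
      · exact ⟨∅, fun h => absurd h hi⟩
    choose T hT using key
    let c : α → List α × Finset α → List α × Finset α := fun i x => (i :: x.1, x.2)
    have hc : ∀ i, Function.Injective (c i) := by
      rintro i ⟨a, b⟩ ⟨a', b'⟩ h
      simpa [c] using h
    refine ⟨(S.biUnion fun i => (T i).image (c i)) ∪ (oddNonsingletons S).image (fun B => ([], B)),
      ?_, ?_⟩
    · ext ⟨τ, B⟩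
      simp only [Finset.coe_union, Finset.coe_biUnion, Finset.coe_image, Set.mem_union,
        Set.mem_iUnion, Set.mem_image, Finset.mem_coe, mem_oddNonsingletons, Prod.mk.injEq,
        admissiblePairsIn, Set.mem_ofPred_eq, exists_prop]
      constructor
      · rintro (⟨i, hi, x, hx, h⟩ | ⟨B', ⟨h1, h2, h3⟩, rfl, rfl⟩)
        · rw [← Finset.mem_coe, (hT i hi).1] at hx
          obtain ⟨h1, h2, h3, h4, h5⟩ := hx
          simp only [c, Prod.mk.injEq] at h
          obtain ⟨rfl, rfl⟩ := h
          refine ⟨?_, ?_, ?_, ?_, h5⟩ <;> grind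
        · exact ⟨by simp, by simp, h1, by simp, h2, h3⟩
      · rintro ⟨h1, h2, h3, h4, h5, h6⟩
        cases τ with
        | nil => exact Or.inr ⟨B, ⟨h3, h5, h6⟩, rfl, rfl⟩
        | cons i τ =>
          have hi : i ∈ S := h2 i (by simp)
          refine Or.inl ⟨i, hi, (τ, B), ?_, rfl⟩
          rw [← Finset.mem_coe, (hT i hi).1]
          refine ⟨?_, ?_, ?_, ?_, h5, h6⟩ <;> grind
    · rw [Finset.card_union_of_disjoint, Finset.card_biUnion,
        Finset.card_image_of_injective _ (Prod.mk_right_injective _),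
        card_oddNonsingletons (Finset.card_pos.1 (by omega)), hn]
      · rw [Finset.sum_congr rfl (fun i hi => (Finset.card_image_of_injective _ (hc i)).trans
          (hT i hi).2)]
        simp [pairCount, hn]
      · intro i _ j _ hij
        simp only [Function.onFun, Finset.disjoint_left, Finset.mem_image, c]
        grind
      · simp only [Finset.disjoint_left, Finset.mem_biUnion, Finset.mem_image, c]
        grind

theorem encard_admissiblePairs (d : ℕ) : (admissiblePairs d).encard = pairCount d := by
  obtain ⟨T, hT, hcard⟩ := exists_finset_admissiblePairsIn (Finset.univ : Finset (Fin d))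
  have h : admissiblePairs d = admissiblePairsIn (Finset.univ : Finset (Fin d)) := by
    ext x
    simp [admissiblePairs, admissiblePairsIn]
  rw [h, ← hT, Set.encard_coe_eq_coe_finsetCard, hcard, Finset.card_univ, Fintype.card_fin]

theorem cast_pairCount_succ {R : Type*} [Ring R] (n : ℕ) :
    (pairCount (n + 1) : R) = (n + 1) * pairCount n + 2 ^ n - (n + 1) := by
  rw [pairCount, Nat.cast_add, Nat.cast_sub Nat.lt_two_pow_self]
  push_cast
  abel

theorem cast_pairCount_eq_sum {d : ℕ} (hd : 3 ≤ d) :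
    (pairCount d : ℚ) = ∑ l ∈ Finset.Icc 3 d,
      (d.factorial : ℚ) / (l.factorial : ℚ) * (2 ^ (l - 1) - (l : ℚ)) := by
  induction d, hd using Nat.le_induction with
  | base => norm_num [pairCount, Nat.factorial]
  | succ n hn ih =>
    rw [Finset.sum_Icc_succ_top (by omega), cast_pairCount_succ, ih, Finset.mul_sum,
      div_self (by positivity), one_mul, Nat.add_sub_cancel, Nat.cast_succ, add_sub_assoc]
    congr 1
    refine Finset.sum_congr rfl fun l _ => ?_
    rw [Nat.factorial_succ]
    push_cast
    ring

/-! ### Convex hulls of sets of vertices of the cube -/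

/-- The vertex of the cube `[0, 1] ^ d` with support `A`. -/
def cubeVertex {d : ℕ} (A : Finset (Fin d)) : Fin d → ℝ := fun i => if i ∈ A then 1 else 0

/-- The convex hull of the vertices of the cube whose supports are the members of `W`. -/
def cubeHull {d : ℕ} (W : Finset (Finset (Fin d))) : Set (Fin d → ℝ) :=
  convexHull ℝ (cubeVertex '' (W : Set (Finset (Fin d))))

theorem cubeVertex_injective {d : ℕ} : Function.Injective (cubeVertex (d := d)) := by
  intro A B h
  ext i
  have := congrFun h i
  simp only [cubeVertex] at this
  split_ifs at this with h1 h2 h2 <;> simp_all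

theorem cubeVertex_mem_extremePoints_cube {d : ℕ} (A : Finset (Fin d)) :
    cubeVertex A ∈ (Set.Icc (0 : Fin d → ℝ) 1).extremePoints ℝ := by
  rw [mem_extremePoints_iff_left]
  refine ⟨⟨fun i => ?_, fun i => ?_⟩, ?_⟩
  · simp only [cubeVertex, Pi.zero_apply]; split_ifs <;> norm_num
  · simp only [cubeVertex, Pi.one_apply]; split_ifs <;> norm_num
  · rintro x hx y hy ⟨a, b, ha, hb, hab, h⟩
    ext i
    have hi := congrFun h i
    have hx0 := hx.1 i
    have hx1 := hx.2 i
    have hy0 := hy.1 i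
    have hy1 := hy.2 i
    simp only [cubeVertex, Pi.add_apply, Pi.smul_apply, smul_eq_mul, Pi.zero_apply,
      Pi.one_apply] at *
    split_ifs at * <;> nlinarith

theorem cubeHull_subset_cube {d : ℕ} (W : Finset (Finset (Fin d))) :
    cubeHull W ⊆ Set.Icc 0 1 := by
  refine convexHull_min ?_ (convex_Icc _ _)
  rintro _ ⟨A, -, rfl⟩
  exact extremePoints_subset (cubeVertex_mem_extremePoints_cube A)

theorem extremePoints_cubeHull {d : ℕ} (W : Finset (Finset (Fin d))) :
    (cubeHull W).extremePoints ℝ = cubeVertex '' (W : Set (Finset (Fin d))) := by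
  refine (extremePoints_convexHull_subset).antisymm ?_
  rintro _ ⟨A, hA, rfl⟩
  exact inter_extremePoints_subset_extremePoints_of_subset (cubeHull_subset_cube W)
    ⟨subset_convexHull ℝ _ ⟨A, hA, rfl⟩, cubeVertex_mem_extremePoints_cube A⟩

theorem cubeVertex_mem_cubeHull {d : ℕ} {A : Finset (Fin d)} {W : Finset (Finset (Fin d))} :
    cubeVertex A ∈ cubeHull W ↔ A ∈ W := by
  refine ⟨fun h => ?_, fun h => subset_convexHull ℝ _ ⟨A, h, rfl⟩⟩
  have : cubeVertex A ∈ (cubeHull W).extremePoints ℝ :=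
    inter_extremePoints_subset_extremePoints_of_subset (cubeHull_subset_cube W)
      ⟨h, cubeVertex_mem_extremePoints_cube A⟩
  rw [extremePoints_cubeHull] at this
  obtain ⟨B, hB, h'⟩ := this
  exact cubeVertex_injective h' ▸ hB

theorem cubeHull_injective {d : ℕ} : Function.Injective (cubeHull (d := d)) := by
  intro W W' h
  ext A
  rw [← cubeVertex_mem_cubeHull, h, cubeVertex_mem_cubeHull]

theorem convexHull_insert_cubeHull {d : ℕ} (A : Finset (Fin d)) (W : Finset (Finset (Fin d))) :
    convexHull ℝ (insert (cubeVertex A) (cubeHull W)) = cubeHull (insert A W) := by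
  refine (convexHull_min ?_ (convex_convexHull ℝ _)).antisymm (convexHull_mono ?_)
  · rw [Set.insert_subset_iff]
    refine ⟨cubeVertex_mem_cubeHull.2 (Finset.mem_insert_self A W), convexHull_mono ?_⟩
    exact Set.image_mono (Finset.coe_subset.2 (Finset.subset_insert A W))
  · rw [Finset.coe_insert, Set.image_insert_eq]
    exact Set.insert_subset_insert (subset_convexHull ℝ _)

/-! ### Faces of such hulls -/

/-- A linear function that is at most `M` on the vertices, with equality on `W'` only, attains `M`
on `cubeHull W` only at points of `cubeHull W'`. -/
theorem le_and_mem_cubeHull_of_eq {d : ℕ} {W W' : Finset (Finset (Fin d))}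
    (l : (Fin d → ℝ) →ₗ[ℝ] ℝ) {M : ℝ}
    (h : ∀ A ∈ W, l (cubeVertex A) ≤ M ∧ (l (cubeVertex A) = M → A ∈ W'))
    {x : Fin d → ℝ} (hx : x ∈ cubeHull W) : l x ≤ M ∧ (l x = M → x ∈ cubeHull W') := by
  refine convexHull_min (t := {x | l x ≤ M ∧ (l x = M → x ∈ cubeHull W')}) ?_ ?_ hx
  · rintro _ ⟨A, hA, rfl⟩
    exact ⟨(h A hA).1, fun h' => cubeVertex_mem_cubeHull.2 ((h A hA).2 h')⟩
  · rw [convex_iff_forall_pos]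
    rintro x ⟨hx, hx'⟩ y ⟨hy, hy'⟩ a b ha hb hab
    simp only [Set.mem_ofPred_eq, map_add, map_smul, smul_eq_mul]
    obtain rfl : b = 1 - a := by linarith
    refine ⟨by nlinarith, fun heq => ?_⟩
    have h1 : l x = M := by nlinarith
    have h2 : l y = M := by nlinarith
    exact convex_convexHull ℝ _ (hx' h1) (hy' h2) ha.le hb.le hab

theorem LinearMap.apply_cubeVertex {d : ℕ} (l : (Fin d → ℝ) →ₗ[ℝ] ℝ) (A : Finset (Fin d)) :
    l (cubeVertex A) = ∑ i ∈ A, l (Pi.single i 1) := by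
  rw [l.pi_apply_eq_sum_univ]
  simp only [cubeVertex, ite_smul, one_smul, zero_smul, Finset.sum_ite_mem, Finset.univ_inter]
  refine Finset.sum_congr rfl fun i _ => congrArg l ?_
  ext j
  simp [Pi.single_apply, eq_comm]

/-- The vertices that maximize a linear function span a face. -/
theorem isFace_cubeHull {d : ℕ} {W W' : Finset (Finset (Fin d))} (hW' : W'.Nonempty)
    (hsub : W' ⊆ W) (a : Fin d → ℝ) {M : ℝ}
    (h : ∀ A ∈ W, ∑ i ∈ A, a i ≤ M ∧ (∑ i ∈ A, a i = M ↔ A ∈ W')) :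
    IsFace (cubeHull W) (cubeHull W') := by
  obtain ⟨B, hB⟩ := hW'
  refine ⟨⟨_, cubeVertex_mem_cubeHull.2 hB⟩, fun _ => ?_⟩
  let l : StrongDual ℝ (Fin d → ℝ) := ∑ i, a i • ContinuousLinearMap.proj i
  have hl : ∀ A, l (cubeVertex A) = ∑ i ∈ A, a i := by
    intro A
    simp [l, cubeVertex]
  have key : ∀ x ∈ cubeHull W, l x ≤ M ∧ (l x = M → x ∈ cubeHull W') := fun x hx =>
    le_and_mem_cubeHull_of_eq (l : (Fin d → ℝ) →ₗ[ℝ] ℝ) (M := M)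
      (fun A hA => ⟨(hl A).trans_le (h A hA).1, fun h' => (h A hA).2.1 ((hl A).symm.trans h')⟩) hx
  have hBM : l (cubeVertex B) = M := (hl B).trans ((h B (hsub hB)).2.2 hB)
  refine ⟨l, Set.Subset.antisymm (fun x hx => ?_) fun x hx => ?_⟩
  · have hxW : x ∈ cubeHull W :=
      convexHull_mono (Set.image_mono (Finset.coe_subset.2 hsub)) hx
    refine ⟨hxW, fun y hy => (key y hy).1.trans ?_⟩
    refine convexHull_min (t := {x | M ≤ l x}) ?_ (convex_halfSpace_ge l.isLinear M) hx
    rintro _ ⟨A, hA, rfl⟩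
    exact ((hl A).trans ((h A (hsub hA)).2.2 hA)).ge
  · exact (key x hx.1).2 ((key x hx.1).1.antisymm
      (hBM.symm.trans_le (hx.2 _ (cubeVertex_mem_cubeHull.2 (hsub hB)))))

/-- Every nonempty face is spanned by the vertices that maximize a linear function. -/
theorem exists_of_isFace_cubeHull {d : ℕ} {W : Finset (Finset (Fin d))} {F : Set (Fin d → ℝ)}
    (hF : IsFace (cubeHull W) F) :
    ∃ (a : Fin d → ℝ) (W' : Finset (Finset (Fin d))), F = cubeHull W' ∧ W' ⊆ W ∧
      ∀ A ∈ W, A ∈ W' ↔ ∀ B ∈ W, ∑ i ∈ B, a i ≤ ∑ i ∈ A, a i := by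
  classical
  obtain ⟨hne, hexp⟩ := hF
  obtain ⟨l, rfl⟩ := hexp hne
  have hWne : W.Nonempty := by
    obtain ⟨x, hx, -⟩ := hne
    by_contra hW
    simp [Finset.not_nonempty_iff_eq_empty.1 hW, cubeHull] at hx
  have hl : ∀ A, l (cubeVertex A) = ∑ i ∈ A, l (Pi.single i 1) :=
    (l : (Fin d → ℝ) →ₗ[ℝ] ℝ).apply_cubeVertex
  obtain ⟨C, hC, hCmax⟩ := W.exists_max_image (fun A => l (cubeVertex A)) hWne
  let W' := W.filter fun A => ∀ B ∈ W, l (cubeVertex B) ≤ l (cubeVertex A)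
  refine ⟨fun i => l (Pi.single i 1), W', ?_, Finset.filter_subset _ _, fun A hA => ?_⟩
  · have key : ∀ x ∈ cubeHull W, l x ≤ l (cubeVertex C) ∧
        (l x = l (cubeVertex C) → x ∈ cubeHull W') := fun x hx =>
      le_and_mem_cubeHull_of_eq (l : (Fin d → ℝ) →ₗ[ℝ] ℝ)
        (fun A hA => ⟨hCmax A hA, fun h' => Finset.mem_filter.2
          ⟨hA, fun B hB => (hCmax B hB).trans (le_of_eq h'.symm)⟩⟩) hx
    refine Set.Subset.antisymm (fun x hx => ?_) fun x hx => ⟨?_, fun y hy => ?_⟩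
    · exact (key x hx.1).2 ((key x hx.1).1.antisymm (hx.2 _ (cubeVertex_mem_cubeHull.2 hC)))
    · exact convexHull_mono (Set.image_mono (Finset.coe_subset.2 (Finset.filter_subset _ _))) hx
    · refine (key y hy).1.trans ?_
      refine convexHull_min (t := {x | l (cubeVertex C) ≤ l x}) ?_
        (convex_halfSpace_ge l.isLinear _) hx
      rintro _ ⟨A, hA, rfl⟩
      exact (Finset.mem_filter.1 hA).2 C hC
  · simp [W', hA, hl]

/-! ### Dimensions of such hulls -/

theorem polyDim_cubeHull {d : ℕ} (W : Finset (Finset (Fin d))) :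
    polyDim (cubeHull W) =
      Module.finrank ℝ (vectorSpan ℝ (cubeVertex '' (W : Set (Finset (Fin d))))) := by
  rw [polyDim, cubeHull, ← direction_affineSpan, affineSpan_convexHull, direction_affineSpan]

theorem polyDim_cubeHull_lt_card {d : ℕ} {W : Finset (Finset (Fin d))} (hW : W.Nonempty) :
    polyDim (cubeHull W) + 1 ≤ W.card := by
  classical
  obtain ⟨n, hn⟩ : ∃ n, W.card = n + 1 := ⟨W.card - 1, by have := hW.card_pos; omega⟩
  have h := finrank_vectorSpan_image_finset_le ℝ (cubeVertex (d := d)) W hn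
  rw [Finset.coe_image, ← polyDim_cubeHull] at h
  omega

theorem card_symmDiff_eq_sum {d : ℕ} (A B : Finset (Fin d)) :
    ((symmDiff A B).card : ℝ) =
      ∑ i, (cubeVertex A i + (1 - 2 * cubeVertex A i) * cubeVertex B i) := by
  rw [Finset.cast_card, ← Finset.univ_inter (symmDiff A B), ← Finset.sum_ite_mem]
  refine Finset.sum_congr rfl fun i _ => ?_
  simp only [cubeVertex, Finset.mem_symmDiff]
  by_cases h1 : i ∈ A <;> by_cases h2 : i ∈ B <;> norm_num [h1, h2]

/-- Vertices of the cube at pairwise Hamming distance `2` are affinely independent: the Hamming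
distance to one of them is an affine function that takes the value `2` on all the others. -/
theorem affineIndependent_cubeVertex {d : ℕ} {W : Finset (Finset (Fin d))}
    (h : ∀ A ∈ W, ∀ B ∈ W, A ≠ B → (symmDiff A B).card = 2) :
    AffineIndependent ℝ (fun A : W => cubeVertex (A : Finset (Fin d))) := by
  rw [affineIndependent_iff]
  intro s w hw hs A hA
  have h1 : ∑ B ∈ s, w B * ((symmDiff (A : Finset (Fin d)) B).card : ℝ) = 0 := by
    simp_rw [card_symmDiff_eq_sum, Finset.mul_sum]
    rw [Finset.sum_comm]
    refine Finset.sum_eq_zero fun i _ => ?_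
    have hi := congrFun hs i
    simp only [Finset.sum_apply, Pi.smul_apply, smul_eq_mul, Pi.zero_apply] at hi
    calc _ = cubeVertex (A : Finset (Fin d)) i * ∑ B ∈ s, w B +
          (1 - 2 * cubeVertex (A : Finset (Fin d)) i) *
            ∑ B ∈ s, w B * cubeVertex (B : Finset (Fin d)) i := by
          rw [Finset.mul_sum, Finset.mul_sum, ← Finset.sum_add_distrib]
          exact Finset.sum_congr rfl fun B _ => by ring
      _ = 0 := by rw [hw, hi]; ring
  have h2 : ∀ B ∈ s, w B * ((symmDiff (A : Finset (Fin d)) B).card : ℝ) =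
      2 * w B - if B = A then 2 * w A else 0 := by
    intro B _
    split_ifs with hBA
    · subst hBA; simp
    · rw [h A A.2 B B.2 (fun h' => hBA (Subtype.ext h'.symm))]
      push_cast
      ring
  rw [Finset.sum_congr rfl h2, Finset.sum_sub_distrib, ← Finset.mul_sum, hw,
    Finset.sum_ite_eq' s A (fun _ => 2 * w A), if_pos hA] at h1
  linarith

theorem range_cubeVertex_coe {d : ℕ} (W : Finset (Finset (Fin d))) :
    Set.range (fun A : W => cubeVertex (A : Finset (Fin d))) =
      cubeVertex '' (W : Set (Finset (Fin d))) := by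
  ext x
  simp

theorem isSimplex_cubeHull {d : ℕ} {W : Finset (Finset (Fin d))} (hW : W.Nonempty)
    (h : ∀ A ∈ W, ∀ B ∈ W, A ≠ B → (symmDiff A B).card = 2) : IsSimplex (cubeHull W) := by
  obtain ⟨n, hn⟩ : ∃ n, W.card = n + 1 := ⟨W.card - 1, by have := hW.card_pos; omega⟩
  let e : Fin (n + 1) ≃ W := (Fintype.equivFinOfCardEq (by simpa using hn)).symm
  refine ⟨n, ⟨_, (affineIndependent_cubeVertex h).comp_embedding e.toEmbedding⟩, ?_⟩
  rw [cubeHull, ← range_cubeVertex_coe]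
  exact congrArg _ (e.surjective.range_comp _).symm

theorem polyDim_cubeHull_of_distance_two {d : ℕ} {W : Finset (Finset (Fin d))} (hW : W.Nonempty)
    (h : ∀ A ∈ W, ∀ B ∈ W, A ≠ B → (symmDiff A B).card = 2) :
    polyDim (cubeHull W) + 1 = W.card := by
  have : Nonempty W := hW.to_subtype
  rw [polyDim_cubeHull, ← range_cubeVertex_coe,
    (affineIndependent_cubeVertex h).finrank_vectorSpan_add_one, Fintype.card_coe]

/-- A simplex has one more vertex than its dimension. -/
theorem card_le_of_isSimplex_cubeHull {d : ℕ} {W : Finset (Finset (Fin d))}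
    (h : IsSimplex (cubeHull W)) : W.card ≤ polyDim (cubeHull W) + 1 := by
  classical
  obtain ⟨n, s, hs⟩ := h
  have hdim : polyDim (cubeHull W) = n := by
    rw [hs, polyDim, ← direction_affineSpan, affineSpan_convexHull, direction_affineSpan,
      s.independent.finrank_vectorSpan (Fintype.card_fin _)]
  have hsub : (W.image cubeVertex : Set (Fin d → ℝ)) ⊆ (Finset.univ.image s.points) := by
    rw [Finset.coe_image, ← extremePoints_cubeHull, hs]
    simpa using extremePoints_convexHull_subset (𝕜 := ℝ) (A := Set.range s.points)
  have := Finset.card_le_card (Finset.coe_subset.1 hsub)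
  rw [Finset.card_image_of_injective _ cubeVertex_injective] at this
  refine this.trans (Finset.card_image_le.trans ?_)
  simp [hdim]

/-! ### Subhalfcubes and the simplices that cut off odd vertices -/

/-- The even vertices that agree with `c` outside `S`: the vertices of a halfcube of dimension
`S.card`, embedded in the coordinate subspace through `c` with directions in `S`. No parity is
required of `c`. -/
def subhalfcube {d : ℕ} (S c : Finset (Fin d)) : Finset (Finset (Fin d)) :=
  Finset.univ.filter fun A => Even A.card ∧ symmDiff A c ⊆ S

/-- The neighbours of the vertex `q` of the cube in the directions of `S`. -/
def neighbours {d : ℕ} (S q : Finset (Fin d)) : Finset (Finset (Fin d)) :=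
  S.image fun i => symmDiff q {i}

theorem mem_subhalfcube {d : ℕ} {S c A : Finset (Fin d)} :
    A ∈ subhalfcube S c ↔ Even A.card ∧ symmDiff A c ⊆ S := by
  simp [subhalfcube]

theorem subhalfcube_congr {d : ℕ} {S c c' : Finset (Fin d)} (h : symmDiff c c' ⊆ S) :
    subhalfcube S c = subhalfcube S c' := by
  ext A
  rw [mem_subhalfcube, mem_subhalfcube]
  simp only [Finset.symmDiff_subset_iff_mem] at *
  grind

theorem halfcube_eq_cubeHull (d : ℕ) : halfcube d = cubeHull (subhalfcube Finset.univ ∅) := by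
  classical
  unfold halfcube cubeHull
  congr 1
  ext p
  simp only [Set.mem_ofPred_eq, Set.mem_image, Finset.mem_coe, mem_subhalfcube,
    Finset.subset_univ, and_true]
  have hsum : ∀ A : Finset (Fin d), ∑ i, cubeVertex A i = A.card := by
    intro A
    simp [cubeVertex]
  constructor
  · rintro ⟨h01, k, hk⟩
    obtain ⟨A, rfl⟩ : ∃ A, cubeVertex A = p := by
      refine ⟨Finset.univ.filter fun i => p i = 1, ?_⟩
      ext i
      rcases h01 i with h | h <;> simp [cubeVertex, h]
    refine ⟨A, ⟨k, ?_⟩, rfl⟩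
    rw [hsum] at hk
    have : A.card = 2 * k := by exact_mod_cast hk
    omega
  · rintro ⟨A, ⟨k, hk⟩, rfl⟩
    refine ⟨fun i => ?_, k, ?_⟩
    · by_cases h : i ∈ A <;> simp [cubeVertex, h]
    · rw [hsum, hk]
      push_cast
      ring

theorem card_symmDiff_singleton_parity {d : ℕ} (A : Finset (Fin d)) (i : Fin d) :
    Even (symmDiff A {i}).card ↔ ¬ Even A.card := by
  rw [Finset.even_card_symmDiff]
  simp

theorem subhalfcube_nonempty {d : ℕ} {S : Finset (Fin d)} (hS : S.Nonempty) (c : Finset (Fin d)) :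
    (subhalfcube S c).Nonempty := by
  obtain ⟨i, hi⟩ := hS
  by_cases h : Even c.card
  · exact ⟨c, mem_subhalfcube.2 ⟨h, by simp⟩⟩
  · refine ⟨symmDiff c {i}, mem_subhalfcube.2 ⟨(card_symmDiff_singleton_parity c i).2 h, ?_⟩⟩
    rw [symmDiff_comm, symmDiff_symmDiff_cancel_left]
    simpa using hi

theorem card_symmDiff_of_mem_subhalfcube {d : ℕ} {S c : Finset (Fin d)} (hS : S.card ≤ 3) :
    ∀ A ∈ subhalfcube S c, ∀ B ∈ subhalfcube S c, A ≠ B → (symmDiff A B).card = 2 := by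
  intro A hA B hB hAB
  rw [mem_subhalfcube] at hA hB
  have heven : Even (symmDiff A B).card :=
    (Finset.even_card_symmDiff A B).2 (iff_of_true hA.1 hB.1)
  have hsub : symmDiff A B ⊆ S := by
    have h1 := hA.2
    have h2 := hB.2
    rw [Finset.symmDiff_subset_iff_mem] at *
    grind
  have hpos : 0 < (symmDiff A B).card := by
    rw [Finset.card_pos, Finset.nonempty_iff_ne_empty]
    exact fun h => hAB (symmDiff_eq_bot.1 h)
  have := Finset.card_le_card hsub
  obtain ⟨k, hk⟩ := heven
  omega

theorem mem_neighbours {d : ℕ} {S q A : Finset (Fin d)} :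
    A ∈ neighbours S q ↔ symmDiff A q ⊆ S ∧ (symmDiff A q).card = 1 := by
  simp only [neighbours, Finset.mem_image, Finset.card_eq_one]
  constructor
  · rintro ⟨i, hi, rfl⟩
    rw [symmDiff_comm, symmDiff_symmDiff_cancel_left]
    exact ⟨by simpa using hi, i, rfl⟩
  · rintro ⟨h, i, hi⟩
    refine ⟨i, h (by simp [hi]), ?_⟩
    rw [← hi, symmDiff_comm A, symmDiff_symmDiff_cancel_left]

theorem card_neighbours {d : ℕ} (S q : Finset (Fin d)) : (neighbours S q).card = S.card :=
  Finset.card_image_of_injective _ fun i j h => by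
    simpa using symmDiff_right_injective q h

theorem card_symmDiff_of_mem_neighbours {d : ℕ} {S q : Finset (Fin d)} :
    ∀ A ∈ neighbours S q, ∀ B ∈ neighbours S q, A ≠ B → (symmDiff A B).card = 2 := by
  intro A hA B hB hAB
  simp only [neighbours, Finset.mem_image] at hA hB
  obtain ⟨i, -, rfl⟩ := hA
  obtain ⟨j, -, rfl⟩ := hB
  have hij : i ≠ j := fun h => hAB (h ▸ rfl)
  have : symmDiff (symmDiff q {i}) (symmDiff q {j}) = {i, j} := by
    rw [symmDiff_symmDiff_symmDiff_comm, symmDiff_self, bot_symmDiff]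
    ext k
    simp only [Finset.mem_symmDiff, Finset.mem_singleton, Finset.mem_insert]
    grind
  rw [this, Finset.card_pair hij]

theorem neighbours_subset_subhalfcube {d : ℕ} {S q : Finset (Fin d)} (hq : Odd q.card) :
    neighbours S q ⊆ subhalfcube S q := by
  intro A hA
  rw [mem_neighbours] at hA
  refine mem_subhalfcube.2 ⟨?_, hA.1⟩
  have := Finset.even_card_symmDiff A q
  rw [hA.2] at this
  rw [← Nat.not_even_iff_odd] at hq
  simp at this
  tauto

/-! ### Dimensions of subhalfcubes -/

theorem finrank_span_single {d : ℕ} (S : Finset (Fin d)) :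
    Module.finrank ℝ (Submodule.span ℝ
      (Set.range fun i : S => (Pi.single (i : Fin d) (1 : ℝ) : Fin d → ℝ))) = S.card := by
  rw [finrank_span_eq_card, Fintype.card_coe]
  have := (Pi.basisFun ℝ (Fin d)).linearIndependent.comp ((↑) : S → Fin d) Subtype.val_injective
  convert this using 1
  ext i j
  simp

theorem polyDim_cubeHull_le {d : ℕ} {W : Finset (Finset (Fin d))} {Z c : Finset (Fin d)}
    (h : W ⊆ subhalfcube Z c) : polyDim (cubeHull W) ≤ Z.card := by
  rw [polyDim_cubeHull, ← finrank_span_single Z]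
  refine Submodule.finrank_mono ?_
  rw [vectorSpan_def, Submodule.span_le]
  rintro _ ⟨_, ⟨A, hA, rfl⟩, _, ⟨B, hB, rfl⟩, rfl⟩
  have hA' := (mem_subhalfcube.1 (h hA)).2
  have hB' := (mem_subhalfcube.1 (h hB)).2
  rw [Finset.symmDiff_subset_iff_mem] at hA' hB'
  have : cubeVertex A -ᵥ cubeVertex B =
      ∑ i : Z, (cubeVertex A i - cubeVertex B i) • Pi.single (i : Fin d) (1 : ℝ) := by
    rw [Finset.sum_coe_sort Z fun i => (cubeVertex A i - cubeVertex B i) • Pi.single i (1 : ℝ)]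
    ext j
    by_cases hj : j ∈ Z
    · simp [Finset.sum_apply, Pi.single_apply, hj]
    · simp [Finset.sum_apply, Pi.single_apply, hj, cubeVertex, (hA' j hj).trans (hB' j hj).symm]
  simp only [this]
  exact Submodule.sum_mem _ fun i _ => Submodule.smul_mem _ _ (Submodule.subset_span ⟨i, rfl⟩)

theorem cubeVertex_symmDiff_pair_sub {d : ℕ} (A : Finset (Fin d)) {i j : Fin d} (hij : i ≠ j) :
    cubeVertex (symmDiff A {i, j}) - cubeVertex A =
      (1 - 2 * cubeVertex A i) • Pi.single i (1 : ℝ) +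
        (1 - 2 * cubeVertex A j) • Pi.single j (1 : ℝ) := by
  ext k
  simp only [cubeVertex, Finset.mem_symmDiff, Finset.mem_insert, Finset.mem_singleton,
    Pi.sub_apply, Pi.add_apply, Pi.smul_apply, Pi.single_apply, smul_eq_mul]
  by_cases h1 : k = i
  · subst h1
    by_cases h2 : k ∈ A <;> norm_num [h2, hij]
  · by_cases h3 : k = j
    · subst h3
      by_cases h2 : k ∈ A <;> norm_num [h2, hij.symm]
    · by_cases h2 : k ∈ A <;> norm_num [h2, h1, h3]

/-- With at least three free directions `i`, `j`, `k`, twice the `i`-th coordinate direction is,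
up to sign, a combination of the three differences that flip two of `i`, `j`, `k`. -/
theorem polyDim_subhalfcube {d : ℕ} {S : Finset (Fin d)} (hS : 3 ≤ S.card) (c : Finset (Fin d)) :
    polyDim (cubeHull (subhalfcube S c)) = S.card := by
  refine (polyDim_cubeHull_le subset_rfl).antisymm ?_
  rw [polyDim_cubeHull]
  conv_lhs => rw [← finrank_span_single S]
  refine Submodule.finrank_mono ?_
  rw [Submodule.span_le]
  rintro _ ⟨⟨i, hi⟩, rfl⟩
  obtain ⟨A, hA⟩ := subhalfcube_nonempty (S := S) (Finset.card_pos.1 (by omega)) c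
  obtain ⟨j, hj⟩ : (S.erase i).Nonempty :=
    Finset.card_pos.1 (by rw [Finset.card_erase_of_mem hi]; omega)
  obtain ⟨k, hk⟩ : ((S.erase i).erase j).Nonempty :=
    Finset.card_pos.1 (by rw [Finset.card_erase_of_mem hj, Finset.card_erase_of_mem hi]; omega)
  simp only [Finset.mem_erase] at hj hk
  have hflip : ∀ x ∈ S, ∀ y ∈ S, x ≠ y → (1 - 2 * cubeVertex A x) • Pi.single x (1 : ℝ) +
      (1 - 2 * cubeVertex A y) • Pi.single y (1 : ℝ) ∈
        vectorSpan ℝ (cubeVertex '' (subhalfcube S c : Set (Finset (Fin d)))) := by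
    intro x hx y hy hxy
    rw [← cubeVertex_symmDiff_pair_sub A hxy]
    refine vsub_mem_vectorSpan ℝ ⟨_, ?_, rfl⟩ ⟨A, hA, rfl⟩
    rw [mem_subhalfcube] at hA
    refine mem_subhalfcube.2 ⟨?_, ?_⟩
    · rw [Finset.even_card_symmDiff, Finset.card_pair hxy]
      simp [hA.1]
    · have := hA.2
      simp only [Finset.symmDiff_subset_iff_mem, Finset.mem_symmDiff] at *
      grind
  have h1 := hflip i hi j hj.2 hj.1.symm
  have h2 := hflip i hi k hk.2.2 hk.2.1.symm
  have h3 := hflip j hj.2 k hk.2.2 hk.1.symm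
  have hsq : (1 - 2 * cubeVertex A i) * (1 - 2 * cubeVertex A i) = 1 := by
    by_cases h : i ∈ A <;> norm_num [cubeVertex, h]
  refine (congrArg (· ∈ vectorSpan ℝ _) ?_).mp (Submodule.smul_mem _
    ((1 - 2 * cubeVertex A i) / 2) (Submodule.sub_mem _ (Submodule.add_mem _ h1 h2) h3))
  ext m
  simp only [Pi.smul_apply, Pi.add_apply, Pi.sub_apply, smul_eq_mul]
  linear_combination (Pi.single i (1 : ℝ) : Fin d → ℝ) m * hsq

/-- Flipping no coordinate or two coordinates of an even vertex already gives
`1 + S.card.choose 2 > S.card + 1` vertices. -/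
theorem card_subhalfcube_gt {d : ℕ} {S : Finset (Fin d)} (hS : 4 ≤ S.card) (c : Finset (Fin d)) :
    S.card + 1 < (subhalfcube S c).card := by
  obtain ⟨A, hA⟩ := subhalfcube_nonempty (S := S) (Finset.card_pos.1 (by omega)) c
  rw [mem_subhalfcube] at hA
  have hsub : (insert ∅ (S.powersetCard 2)).image (symmDiff A) ⊆ subhalfcube S c := by
    intro B hB
    obtain ⟨T, hT, rfl⟩ := Finset.mem_image.1 hB
    have hT' : T ⊆ S ∧ Even T.card := by
      rcases Finset.mem_insert.1 hT with rfl | hT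
      · simp
      · rw [Finset.mem_powersetCard] at hT
        exact ⟨hT.1, by simp [hT.2]⟩
    refine mem_subhalfcube.2 ⟨(Finset.even_card_symmDiff A T).2 (iff_of_true hA.1 hT'.2), ?_⟩
    have h1 := hA.2
    have h2 := hT'.1
    simp only [Finset.symmDiff_subset_iff_mem, Finset.mem_symmDiff] at *
    grind
  refine lt_of_lt_of_le ?_ (Finset.card_le_card hsub)
  rw [Finset.card_image_of_injective _ (symmDiff_right_injective A),
    Finset.card_insert_of_notMem (by simp [Finset.mem_powersetCard]), Finset.card_powersetCard,
    Nat.choose_two_right]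
  have : S.card * 3 ≤ S.card * (S.card - 1) := 
    Nat.mul_le_mul_left _ (show 3 ≤ S.card - 1 by omega)
  omega

theorem not_isSimplex_subhalfcube {d : ℕ} {S : Finset (Fin d)} (hS : 4 ≤ S.card)
    (c : Finset (Fin d)) : ¬ IsSimplex (cubeHull (subhalfcube S c)) := by
  intro h
  have := card_le_of_isSimplex_cubeHull h
  rw [polyDim_subhalfcube (by omega)] at this
  have := card_subhalfcube_gt hS c
  omega

/-! ### Faces and facets of subhalfcubes -/

/-- If the signs of the coefficients `a` match the vertex `g`, so that `g` maximizes the linear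
function `a` over the cube, then the value at `A` falls short of the maximum by the sum of the
`|a i|` over the coordinates `i` in which `A` differs from `g`. -/
theorem sum_add_sum_abs_symmDiff {d : ℕ} {a : Fin d → ℝ} {g A : Finset (Fin d)}
    (h : ∀ i ∈ symmDiff A g, (i ∈ g → 0 ≤ a i) ∧ (i ∉ g → a i ≤ 0)) :
    ∑ i ∈ A, a i + ∑ i ∈ symmDiff A g, |a i| = ∑ i ∈ g, a i := by
  have hconv : ∀ (B : Finset (Fin d)) (f : Fin d → ℝ),
      ∑ i ∈ B, f i = ∑ i, if i ∈ B then f i else 0 := by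
    intro B f
    rw [Finset.sum_ite_mem, Finset.univ_inter]
  rw [hconv A, hconv g, hconv (symmDiff A g), ← Finset.sum_add_distrib]
  refine Finset.sum_congr rfl fun i _ => ?_
  have hi := h i
  simp only [Finset.mem_symmDiff] at hi ⊢
  by_cases h1 : i ∈ A <;> by_cases h2 : i ∈ g
  · simp [h1, h2]
  · simp [h1, h2, abs_of_nonpos ((hi (Or.inl ⟨h1, h2⟩)).2 h2)]
  · simp [h1, h2, abs_of_nonneg ((hi (Or.inr ⟨h2, h1⟩)).1 h2)]
  · simp [h1, h2]

theorem isFace_subhalfcube {d : ℕ} {S Z : Finset (Fin d)} (hZ : Z.Nonempty) (hZS : Z ⊆ S)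
    (c : Finset (Fin d)) :
    IsFace (cubeHull (subhalfcube S c)) (cubeHull (subhalfcube Z c)) := by
  let a : Fin d → ℝ := fun i => if i ∈ Z then 0 else if i ∈ c then 1 else -1
  refine isFace_cubeHull (subhalfcube_nonempty hZ c) ?_ a (M := ∑ i ∈ c, a i) ?_
  · intro A hA
    rw [mem_subhalfcube] at *
    exact ⟨hA.1, hA.2.trans hZS⟩
  · intro A hA
    have hloss := sum_add_sum_abs_symmDiff (a := a) (g := c) (A := A) (by
      intro i _
      simp only [a]
      constructor <;> intro h <;> split_ifs <;> norm_num)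
    rw [mem_subhalfcube] at hA
    have hnn : ∀ i ∈ symmDiff A c, 0 ≤ |a i| := fun i _ => abs_nonneg _
    refine ⟨by linarith [Finset.sum_nonneg hnn], ?_⟩
    rw [← hloss, left_eq_add, Finset.sum_eq_zero_iff_of_nonneg hnn, mem_subhalfcube,
      and_iff_right hA.1, Finset.subset_iff]
    refine forall₂_congr fun i _ => ?_
    simp only [a, abs_eq_zero]
    split_ifs <;> simp_all

theorem isFace_neighbours {d : ℕ} {S q : Finset (Fin d)} (hS : S.Nonempty) (hq : Odd q.card) :
    IsFace (cubeHull (subhalfcube S q)) (cubeHull (neighbours S q)) := by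
  let a : Fin d → ℝ := fun i => if i ∈ q then 1 else -1
  refine isFace_cubeHull (hS.image _) (neighbours_subset_subhalfcube hq) a
    (M := ∑ i ∈ q, a i - 1) ?_
  intro A hA
  have hloss := sum_add_sum_abs_symmDiff (a := a) (g := q) (A := A) (by
    intro i _
    simp only [a]
    constructor <;> intro h <;> simp [h])
  have habs : ∀ i, |a i| = 1 := by
    intro i
    simp only [a]
    split_ifs <;> simp
  simp only [habs, Finset.sum_const, nsmul_eq_mul, mul_one] at hloss
  rw [mem_subhalfcube] at hA
  have hpos : 1 ≤ (symmDiff A q).card := by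
    rw [Nat.one_le_iff_ne_zero]
    intro h
    obtain rfl : A = q := symmDiff_eq_bot.1 (Finset.card_eq_zero.1 h)
    exact Nat.not_even_iff_odd.2 hq hA.1
  rw [mem_neighbours, and_iff_right hA.2]
  refine ⟨?_, ?_⟩
  · have : (1 : ℝ) ≤ (symmDiff A q).card := by exact_mod_cast hpos
    linarith
  · rw [← hloss, ← Nat.cast_eq_one (R := ℝ)]
    constructor <;> intro h <;> linarith

/-- A facet of a subhalfcube is either obtained by fixing one coordinate, or cuts off a vertex `q`
of the cube of odd parity. For a linear function `a`, the two cases arise according to whether or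
not some coefficient of `a` in a free direction vanishes. -/
theorem facet_subhalfcube {d : ℕ} {S c : Finset (Fin d)} (hS : 4 ≤ S.card)
    {F : Set (Fin d → ℝ)} (hF : IsFacet (cubeHull (subhalfcube S c)) F) :
    (∃ i ∈ S, ∃ g, symmDiff g c ⊆ S ∧ F = cubeHull (subhalfcube (S.erase i) g)) ∨
      ∃ q, Odd q.card ∧ symmDiff q c ⊆ S ∧ F = cubeHull (neighbours S q) := by
  classical
  obtain ⟨hface, hdim⟩ := hF
  obtain ⟨a, W, rfl, hWsub, hW⟩ := exists_of_isFace_cubeHull hface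
  have hWne : W.Nonempty := by
    obtain ⟨⟨x, hx⟩, -⟩ := hface
    by_contra h
    simp [Finset.not_nonempty_iff_eq_empty.1 h, cubeHull] at hx
  rw [polyDim_subhalfcube (by omega)] at hdim
  -- `g` maximizes the linear function over the vertices of the cube that agree with `c` off `S`
  obtain ⟨g, hg⟩ : ∃ g : Finset (Fin d), ∀ i, i ∈ g ↔ if i ∈ S then 0 < a i else i ∈ c :=
    ⟨Finset.univ.filter fun i => if i ∈ S then 0 < a i else i ∈ c, by simp⟩
  have hgc : symmDiff g c ⊆ S := by
    rw [Finset.symmDiff_subset_iff_mem]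
    intro i hi
    rw [hg, if_neg hi]
  rw [← subhalfcube_congr hgc] at hWsub hW
  have hloss : ∀ A ∈ subhalfcube S g,
      ∑ i ∈ A, a i + ∑ i ∈ symmDiff A g, |a i| = ∑ i ∈ g, a i := by
    intro A hA
    refine sum_add_sum_abs_symmDiff fun i hi => ?_
    rw [hg, if_pos ((mem_subhalfcube.1 hA).2 hi)]
    exact ⟨le_of_lt, le_of_not_gt⟩
  have hle : ∀ A ∈ W, ∀ B ∈ subhalfcube S g,
      ∑ i ∈ symmDiff A g, |a i| ≤ ∑ i ∈ symmDiff B g, |a i| := by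
    intro A hA B hB
    have h1 := hloss A (hWsub hA)
    have h2 := hloss B hB
    have h3 := (hW A (hWsub hA)).1 hA B hB
    linarith
  have hcard := polyDim_cubeHull_lt_card hWne
  by_cases hzero : ∃ i ∈ S, a i = 0
  · left
    have hZne : (S.filter fun i => a i = 0).Nonempty := by
      obtain ⟨i, hi, hi'⟩ := hzero
      exact ⟨i, Finset.mem_filter.2 ⟨hi, hi'⟩⟩
    obtain ⟨B, hB⟩ := subhalfcube_nonempty hZne g
    rw [mem_subhalfcube] at hB
    have hBsum : ∑ i ∈ symmDiff B g, |a i| = 0 :=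
      Finset.sum_eq_zero fun i hi => by rw [(Finset.mem_filter.1 (hB.2 hi)).2, abs_zero]
    have hBS : B ∈ subhalfcube S g :=
      mem_subhalfcube.2 ⟨hB.1, hB.2.trans (Finset.filter_subset _ _)⟩
    have hWeq : W = subhalfcube (S.filter fun i => a i = 0) g := by
      ext A
      rw [mem_subhalfcube]
      constructor
      · intro hA
        have hAS := mem_subhalfcube.1 (hWsub hA)
        have h0 := ((hle A hA B hBS).trans_eq hBsum).antisymm
          (Finset.sum_nonneg fun i _ => abs_nonneg _)
        rw [Finset.sum_eq_zero_iff_of_nonneg fun i _ => abs_nonneg _] at h0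
        exact ⟨hAS.1, fun i hi => Finset.mem_filter.2 ⟨hAS.2 hi, abs_eq_zero.1 (h0 i hi)⟩⟩
      · rintro ⟨h1, h2⟩
        have hAS : A ∈ subhalfcube S g :=
          mem_subhalfcube.2 ⟨h1, h2.trans (Finset.filter_subset _ _)⟩
        refine (hW A hAS).2 fun C hC => ?_
        have h0 : ∑ i ∈ symmDiff A g, |a i| = 0 :=
          Finset.sum_eq_zero fun i hi => by rw [(Finset.mem_filter.1 (h2 hi)).2, abs_zero]
        have h3 := hloss A hAS
        have h4 := hloss C hC
        have h5 : 0 ≤ ∑ i ∈ symmDiff C g, |a i| := Finset.sum_nonneg fun i _ => abs_nonneg _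
        linarith
    have hZle := polyDim_cubeHull_le hWeq.le
    obtain ⟨i, hi, hai⟩ : ∃ i ∈ S, a i ≠ 0 := by
      by_contra! hall
      rw [hWeq, Finset.filter_true_of_mem hall, polyDim_subhalfcube (by omega)] at hdim
      omega
    have hZeq : (S.filter fun i => a i = 0) = S.erase i := by
      refine Finset.eq_of_subset_of_card_le ?_ ?_
      · intro j hj
        rw [Finset.mem_filter] at hj
        exact Finset.mem_erase.2 ⟨fun h => hai (h ▸ hj.2), hj.1⟩
      · rw [Finset.card_erase_of_mem hi]
        omega
    exact ⟨i, hi, g, hgc, by rw [hWeq, hZeq]⟩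
  · right
    have habs : ∀ i ∈ S, 0 < |a i| := fun i hi => abs_pos.2 fun h => hzero ⟨i, hi, h⟩
    by_cases hgeven : Even g.card
    · -- an even `g` is the only maximizer, and a single point has dimension `0`
      have : W ⊆ {g} := by
        intro A hA
        have h0 := hle A hA g (mem_subhalfcube.2 ⟨hgeven, by simp⟩)
        rw [symmDiff_self, Finset.bot_eq_empty, Finset.sum_empty] at h0
        by_contra hne
        have hne' : (symmDiff A g).Nonempty :=
          Finset.nonempty_iff_ne_empty.2 fun h => hne (by simpa using symmDiff_eq_bot.1 h)
        have := Finset.sum_pos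
          (fun i hi => habs i ((mem_subhalfcube.1 (hWsub hA)).2 hi)) hne'
        linarith
      have h0 := polyDim_cubeHull_le (Z := ∅) (c := g) (W := W) fun A hA => by
        obtain rfl := Finset.mem_singleton.1 (this hA)
        exact mem_subhalfcube.2 ⟨hgeven, by simp⟩
      rw [Finset.card_empty] at h0
      omega
    · have hgodd := Nat.not_even_iff_odd.1 hgeven
      refine ⟨g, hgodd, hgc, congrArg cubeHull (Finset.eq_of_subset_of_card_le ?_ ?_)⟩
      · intro A hA
        have hAS := mem_subhalfcube.1 (hWsub hA)
        rw [mem_neighbours]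
        refine ⟨hAS.2, ?_⟩
        have hne : (symmDiff A g).Nonempty := Finset.nonempty_iff_ne_empty.2 fun h =>
          hgeven ((symmDiff_eq_bot.1 h : A = g) ▸ hAS.1)
        obtain ⟨i, hi⟩ := hne
        have hB := hle A hA _ (neighbours_subset_subhalfcube hgodd
          (Finset.mem_image_of_mem (fun j => symmDiff g {j}) (hAS.2 hi)))
        rw [symmDiff_comm (symmDiff g {i}) g, symmDiff_symmDiff_cancel_left,
          Finset.sum_singleton] at hB
        by_contra hcard1
        obtain ⟨j, hj, hji⟩ : ∃ j ∈ symmDiff A g, j ≠ i := by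
          by_contra! hall
          exact hcard1 (Finset.card_eq_one.2 ⟨i, Finset.eq_singleton_iff_unique_mem.2 ⟨hi, hall⟩⟩)
        have h2 : ∑ k ∈ {i, j}, |a k| ≤ ∑ k ∈ symmDiff A g, |a k| :=
          Finset.sum_le_sum_of_subset_of_nonneg
            (by intro k; simp only [Finset.mem_insert, Finset.mem_singleton]; grind)
            fun _ _ _ => abs_nonneg _
        rw [Finset.sum_pair hji.symm] at h2
        have := habs j (hAS.2 hj)
        linarith
      · rw [card_neighbours]
        omega

/-- The facets that avoid the vertex `v`: one for each free direction `i`, in which the `i`-th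
coordinate is fixed to the value opposite to that of `v`, and one for each odd vertex of the cube
that is not a neighbour of `v`. -/
theorem isFacet_subhalfcube_and_notMem_iff {d : ℕ} {S v : Finset (Fin d)} (hS : 4 ≤ S.card)
    (hv : Even v.card) {F : Set (Fin d → ℝ)} :
    (IsFacet (cubeHull (subhalfcube S v)) F ∧ cubeVertex v ∉ F) ↔
      (∃ i ∈ S, F = cubeHull (subhalfcube (S.erase i) (symmDiff v {i}))) ∨
        ∃ T ∈ oddNonsingletons S, F = cubeHull (neighbours S (symmDiff v T)) := by
  constructor
  · rintro ⟨hF, hvF⟩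
    rcases facet_subhalfcube hS hF with ⟨i, hi, g, hg, rfl⟩ | ⟨q, hq, hqS, rfl⟩
    · left
      refine ⟨i, hi, congrArg _ (subhalfcube_congr ?_)⟩
      rw [cubeVertex_mem_cubeHull, mem_subhalfcube, not_and] at hvF
      have hvg := hvF hv
      simp only [Finset.symmDiff_subset_iff_mem, Finset.mem_symmDiff] at *
      grind
    · right
      refine ⟨symmDiff v q, ?_, by rw [symmDiff_symmDiff_cancel_left]⟩
      rw [symmDiff_comm] at hqS
      rw [cubeVertex_mem_cubeHull, mem_neighbours, not_and] at hvF
      refine mem_oddNonsingletons.2 ⟨hqS, ?_, hvF hqS⟩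
      rw [← Nat.not_even_iff_odd, Finset.even_card_symmDiff]
      rw [← Nat.not_even_iff_odd] at hq
      tauto
  · rintro (⟨i, hi, rfl⟩ | ⟨T, hT, rfl⟩)
    · have hcard := Finset.card_erase_of_mem hi
      refine ⟨⟨?_, ?_⟩, ?_⟩
      · rw [subhalfcube_congr (S := S) (c := v) (c' := symmDiff v {i})
          (by rw [symmDiff_symmDiff_cancel_left]; simpa using hi)]
        exact isFace_subhalfcube (Finset.card_pos.1 (by omega)) (Finset.erase_subset _ _) _
      · rw [polyDim_subhalfcube (by omega), polyDim_subhalfcube (by omega)]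
        omega
      · rw [cubeVertex_mem_cubeHull, mem_subhalfcube, symmDiff_symmDiff_cancel_left]
        simp
    · obtain ⟨hTS, hTodd, hT1⟩ := mem_oddNonsingletons.1 hT
      have hq : Odd (symmDiff v T).card := by
        rw [← Nat.not_even_iff_odd, Finset.even_card_symmDiff]
        rw [← Nat.not_even_iff_odd] at hTodd
        tauto
      have hSne : S.Nonempty := Finset.card_pos.1 (by omega)
      refine ⟨⟨?_, ?_⟩, ?_⟩
      · rw [subhalfcube_congr (S := S) (c := v) (c' := symmDiff v T)
          (by rwa [symmDiff_symmDiff_cancel_left])]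
        exact isFace_neighbours hSne hq
      · rw [polyDim_subhalfcube (by omega), polyDim_cubeHull_of_distance_two
          (W := neighbours S (symmDiff v T)) (hSne.image _) card_symmDiff_of_mem_neighbours]
        exact card_neighbours _ _
      · rw [cubeVertex_mem_cubeHull, mem_neighbours, symmDiff_symmDiff_cancel_left]
        exact fun h => hT1 h.2

/-! ### Counting the simplices of the pulling triangulation -/

theorem insert_injective_of_notMem {α : Type*} [DecidableEq α] {u : α} {W W' : Finset α}
    (h : u ∉ W) (h' : u ∉ W') (heq : insert u W = insert u W') : W = W' := by
  rw [← Finset.erase_insert h, heq, Finset.erase_insert h']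

/-- If `q ≠ q'` have the same neighbours in the directions of `S`, then flipping any one `i ∈ S`
brings `q` to distance `1` from `q'`; so `q` and `q'` differ in all of `S`, and in at most one
element besides `i`, which is impossible for `3 ≤ S.card`. -/
theorem neighbours_injective {d : ℕ} {S : Finset (Fin d)} (hS : 3 ≤ S.card) :
    Function.Injective (neighbours S) := by
  intro q q' h
  by_contra hne
  have hsub : ∀ i ∈ S, ∀ j ∈ symmDiff q q', j ≠ i →
      ∀ k ∈ symmDiff q q', k ≠ i → j = k := by
    intro i hi j hj hji k hk hki
    have hmem : symmDiff q {i} ∈ neighbours S q' :=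
      h ▸ Finset.mem_image_of_mem (fun j => symmDiff q {j}) hi
    obtain ⟨m, hm⟩ := Finset.card_eq_one.1 (mem_neighbours.1 hmem).2
    have hj' : j ∈ ({m} : Finset (Fin d)) := by
      rw [← hm]
      simp only [Finset.mem_symmDiff, Finset.mem_singleton] at *
      grind
    have hk' : k ∈ ({m} : Finset (Fin d)) := by
      rw [← hm]
      simp only [Finset.mem_symmDiff, Finset.mem_singleton] at *
      grind
    rw [Finset.mem_singleton.1 hj', Finset.mem_singleton.1 hk']
  have hall : ∀ i ∈ S, i ∈ symmDiff q q' := by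
    intro i hi
    have hmem : symmDiff q {i} ∈ neighbours S q' :=
      h ▸ Finset.mem_image_of_mem (fun j => symmDiff q {j}) hi
    have hcard := (mem_neighbours.1 hmem).2
    by_contra hnot
    rw [symmDiff_right_comm] at hcard
    have hpair : (symmDiff (symmDiff q q') {i}).card = (symmDiff q q').card + 1 := by
      rw [Disjoint.symmDiff_eq_sup (by simpa using hnot), Finset.sup_eq_union,
        Finset.card_union_of_disjoint (by simpa using hnot), Finset.card_singleton]
    have : (symmDiff q q').card = 0 := by omega
    exact hne (symmDiff_eq_bot.1 (Finset.card_eq_zero.1 this))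
  obtain ⟨i, j, k, hi, hj, hk, hij, hik, hjk⟩ := Finset.two_lt_card_iff.1 (show 2 < S.card from hS)
  exact hjk (hsub i hi j (hall j hj) hij.symm k (hall k hk) hik.symm)

theorem mem_subhalfcube_erase_symmDiff {d : ℕ} {S v A : Finset (Fin d)} {i : Fin d}
    (hA : A ∈ subhalfcube (S.erase i) (symmDiff v {i})) : i ∈ A ↔ i ∉ v := by
  have := (Finset.symmDiff_subset_iff_mem.1 (mem_subhalfcube.1 hA).2) i (by simp)
  simpa [Finset.mem_symmDiff] using this

theorem exists_mem_and_exists_notMem_subhalfcube {d : ℕ} {S c : Finset (Fin d)}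
    (hS : 2 ≤ S.card) {j : Fin d} (hj : j ∈ S) :
    (∃ A ∈ subhalfcube S c, j ∈ A) ∧ ∃ A ∈ subhalfcube S c, j ∉ A := by
  obtain ⟨A, hA⟩ := subhalfcube_nonempty ⟨j, hj⟩ c
  obtain ⟨k, hk⟩ : (S.erase j).Nonempty :=
    Finset.card_pos.1 (by rw [Finset.card_erase_of_mem hj]; omega)
  obtain ⟨hkj, hk⟩ := Finset.mem_erase.1 hk
  have hB : symmDiff A {j, k} ∈ subhalfcube S c := by
    rw [mem_subhalfcube] at *
    refine ⟨?_, ?_⟩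
    · rw [Finset.even_card_symmDiff, Finset.card_pair hkj.symm]
      simp [hA.1]
    · have := hA.2
      simp only [Finset.symmDiff_subset_iff_mem, Finset.mem_symmDiff] at *
      grind
  by_cases hjA : j ∈ A
  · exact ⟨⟨A, hA, hjA⟩, _, hB, by simp [Finset.mem_symmDiff, hjA]⟩
  · exact ⟨⟨_, hB, by simp [Finset.mem_symmDiff, hjA]⟩, A, hA, hjA⟩

theorem exists_mem_and_exists_notMem_neighbours {d : ℕ} {S q : Finset (Fin d)}
    (hS : 2 ≤ S.card) {j : Fin d} (hj : j ∈ S) :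
    (∃ A ∈ neighbours S q, j ∈ A) ∧ ∃ A ∈ neighbours S q, j ∉ A := by
  obtain ⟨k, hk⟩ : (S.erase j).Nonempty :=
    Finset.card_pos.1 (by rw [Finset.card_erase_of_mem hj]; omega)
  obtain ⟨hkj, hk⟩ := Finset.mem_erase.1 hk
  have h1 : symmDiff q {j} ∈ neighbours S q := Finset.mem_image_of_mem _ hj
  have h2 : symmDiff q {k} ∈ neighbours S q := Finset.mem_image_of_mem _ hk
  by_cases hjq : j ∈ q
  · exact ⟨⟨_, h2, by simp [Finset.mem_symmDiff, hjq, hkj.symm]⟩, _, h1,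
      by simp [Finset.mem_symmDiff, hjq]⟩
  · exact ⟨⟨_, h1, by simp [Finset.mem_symmDiff, hjq]⟩, _, h2,
      by simp [Finset.mem_symmDiff, hjq, hkj.symm]⟩

/-- The pulling triangulation of a subhalfcube, described by the vertex sets of its simplices.
The induction carries along that no coordinate in a free direction is constant on a simplex.
Hence a simplex is contained in at most one facet, and no simplex is counted twice when the
triangulations of the facets are joined to the pulled vertex. -/
theorem exists_finset_pull_subhalfcube {d : ℕ} {r : (Fin d → ℝ) → (Fin d → ℝ) → Prop}
    (hr : ∀ S c : Finset (Fin d), 4 ≤ S.card →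
      ∃ v, ∀ w, IsMinVertex r (cubeHull (subhalfcube S c)) w ↔ w = v)
    {n : ℕ} (hn : 3 ≤ n) (S c : Finset (Fin d)) (hS : S.card = n) :
    ∃ 𝒯 : Finset (Finset (Finset (Fin d))),
      pull r (cubeHull (subhalfcube S c)) = cubeHull '' (𝒯 : Set (Finset (Finset (Fin d)))) ∧
      (∀ W ∈ 𝒯, W ⊆ subhalfcube S c ∧ ∀ j ∈ S, (∃ A ∈ W, j ∈ A) ∧ ∃ A ∈ W, j ∉ A) ∧
      𝒯.card = pairCount n := by
  induction n, hn using Nat.le_induction generalizing S c with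
  | base =>
    refine ⟨{subhalfcube S c}, ?_, ?_, rfl⟩
    · rw [Finset.coe_singleton, Set.image_singleton, pull_of_isSimplex]
      exact isSimplex_cubeHull (subhalfcube_nonempty (Finset.card_pos.1 (by omega)) c)
        (card_symmDiff_of_mem_subhalfcube hS.le)
    · intro W hW
      obtain rfl := Finset.mem_singleton.1 hW
      exact ⟨subset_rfl, fun j hj => exists_mem_and_exists_notMem_subhalfcube (by omega) hj⟩
  | succ n hn ih =>
    have hS4 : 4 ≤ S.card := by omega
    obtain ⟨v, hv⟩ := hr S c hS4
    obtain ⟨u, hu, rfl⟩ : v ∈ cubeVertex '' (subhalfcube S c : Set (Finset (Fin d))) := by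
      rw [← extremePoints_cubeHull]
      exact ((hv v).2 rfl).1
    rw [Finset.mem_coe, mem_subhalfcube] at hu
    rw [← subhalfcube_congr hu.2] at hv ⊢
    have hueven := hu.1
    have key : ∀ i, ∃ T : Finset (Finset (Finset (Fin d))), i ∈ S →
        pull r (cubeHull (subhalfcube (S.erase i) (symmDiff u {i}))) =
          cubeHull '' (T : Set (Finset (Finset (Fin d)))) ∧
        (∀ W ∈ T, W ⊆ subhalfcube (S.erase i) (symmDiff u {i}) ∧
          ∀ j ∈ S.erase i, (∃ A ∈ W, j ∈ A) ∧ ∃ A ∈ W, j ∉ A) ∧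
        T.card = pairCount n := by
      intro i
      by_cases hi : i ∈ S
      · obtain ⟨T, hT⟩ := ih (S.erase i) (symmDiff u {i})
          (by rw [Finset.card_erase_of_mem hi]; omega)
        exact ⟨T, fun _ => hT⟩
      · exact ⟨∅, fun h => absurd h hi⟩
    choose T hT using key
    have huT : ∀ i ∈ S, ∀ W ∈ T i, u ∉ W := fun i hi W hW hmem => by
      have := mem_subhalfcube_erase_symmDiff (((hT i hi).2.1 W hW).1 hmem)
      tauto
    have huN : ∀ X ∈ oddNonsingletons S, u ∉ neighbours S (symmDiff u X) := fun X hX hmem => by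
      rw [mem_neighbours, symmDiff_symmDiff_cancel_left] at hmem
      exact (mem_oddNonsingletons.1 hX).2.2 hmem.2
    -- the `i`-th coordinate is constant on the simplices that come from the facet fixing it
    have hconst : ∀ i ∈ S, ∀ W ∈ T i, ¬ ((∃ A ∈ W, i ∈ A) ∧ ∃ A ∈ W, i ∉ A) := by
      rintro i hi W hW ⟨⟨A, hA, hiA⟩, B, hB, hiB⟩
      have h1 := mem_subhalfcube_erase_symmDiff (((hT i hi).2.1 W hW).1 hA)
      have h2 := mem_subhalfcube_erase_symmDiff (((hT i hi).2.1 W hW).1 hB)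
      tauto
    refine ⟨(S.biUnion fun i => (T i).image (insert u)) ∪
      (oddNonsingletons S).image (fun X => insert u (neighbours S (symmDiff u X))), ?_, ?_, ?_⟩
    · rw [pull_of_not_isSimplex r _ _ (not_isSimplex_subhalfcube hS4 u) hv]
      have hpullN : ∀ X, pull r (cubeHull (neighbours S (symmDiff u X))) =
          {cubeHull (neighbours S (symmDiff u X))} := fun X =>
        pull_of_isSimplex r _ (isSimplex_cubeHull
          (Finset.Nonempty.image (Finset.card_pos.1 (by omega)) _)
          card_symmDiff_of_mem_neighbours)
      ext Q
      simp only [Set.mem_ofPred_eq, isFacet_subhalfcube_and_notMem_iff hS4 hueven,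
        Set.mem_iUnion, exists_prop, Finset.coe_union, Finset.coe_biUnion, Finset.coe_image,
        Set.mem_image, Set.mem_union, Finset.mem_coe]
      constructor
      · rintro ⟨_, (⟨i, hi, rfl⟩ | ⟨X, hX, rfl⟩), Q, hQ, rfl⟩
        · rw [(hT i hi).1] at hQ
          obtain ⟨W, hW, rfl⟩ := hQ
          exact ⟨insert u W, Or.inl ⟨i, hi, W, hW, rfl⟩, (convexHull_insert_cubeHull u W).symm⟩
        · rw [hpullN, Set.mem_singleton_iff] at hQ
          subst hQ
          exact ⟨_, Or.inr ⟨X, hX, rfl⟩, (convexHull_insert_cubeHull u _).symm⟩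
      · rintro ⟨_, (⟨i, hi, W, hW, rfl⟩ | ⟨X, hX, rfl⟩), rfl⟩
        · refine ⟨_, Or.inl ⟨i, hi, rfl⟩, cubeHull W, ?_, convexHull_insert_cubeHull u W⟩
          rw [(hT i hi).1]
          exact Set.mem_image_of_mem _ hW
        · exact ⟨_, Or.inr ⟨X, hX, rfl⟩, _, by rw [hpullN]; rfl, convexHull_insert_cubeHull u _⟩
    · have huS : u ∈ subhalfcube S u := mem_subhalfcube.2 ⟨hueven, by simp⟩
      intro W hW
      simp only [Finset.mem_union, Finset.mem_biUnion, Finset.mem_image] at hW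
      rcases hW with ⟨i, hi, W, hW, rfl⟩ | ⟨X, hX, rfl⟩
      · obtain ⟨hsub, hcoord⟩ := (hT i hi).2.1 W hW
        refine ⟨Finset.insert_subset huS fun A hA => ?_, fun j hj => ?_⟩
        · have hA' := mem_subhalfcube.1 (hsub hA)
          refine mem_subhalfcube.2 ⟨hA'.1, ?_⟩
          have := hA'.2
          simp only [Finset.symmDiff_subset_iff_mem, Finset.mem_symmDiff, Finset.mem_erase,
            Finset.mem_singleton] at *
          grind
        · by_cases hji : j = i
          · subst hji
            obtain ⟨k, hk⟩ : (S.erase j).Nonempty :=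
              Finset.card_pos.1 (by rw [Finset.card_erase_of_mem hj]; omega)
            obtain ⟨A, hA, -⟩ := (hcoord k hk).1
            have := mem_subhalfcube_erase_symmDiff (hsub hA)
            by_cases hju : j ∈ u
            · exact ⟨⟨u, by simp, hju⟩, A, by simp [hA], by tauto⟩
            · exact ⟨⟨A, by simp [hA], by tauto⟩, u, by simp, hju⟩
          · obtain ⟨⟨A, hA, hjA⟩, B, hB, hjB⟩ := hcoord j (Finset.mem_erase.2 ⟨hji, hj⟩)
            exact ⟨⟨A, by simp [hA], hjA⟩, B, by simp [hB], hjB⟩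
      · obtain ⟨hXS, hXodd, -⟩ := mem_oddNonsingletons.1 hX
        refine ⟨Finset.insert_subset huS ?_, fun j hj => ?_⟩
        · rw [subhalfcube_congr (S := S) (c := u) (c' := symmDiff u X)
            (by rwa [symmDiff_symmDiff_cancel_left])]
          refine neighbours_subset_subhalfcube ?_
          rw [← Nat.not_even_iff_odd, Finset.even_card_symmDiff]
          rw [← Nat.not_even_iff_odd] at hXodd
          tauto
        · obtain ⟨⟨A, hA, hjA⟩, B, hB, hjB⟩ :=
            exists_mem_and_exists_notMem_neighbours (q := symmDiff u X) (by omega) hj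
          exact ⟨⟨A, by simp [hA], hjA⟩, B, by simp [hB], hjB⟩
    · rw [Finset.card_union_of_disjoint, Finset.card_biUnion, Finset.card_image_of_injOn,
        card_oddNonsingletons (Finset.card_pos.1 (by omega)), hS]
      · rw [Finset.sum_congr rfl fun i hi => (Finset.card_image_of_injOn fun W hW W' hW' h =>
          insert_injective_of_notMem (huT i hi W hW) (huT i hi W' hW') h).trans (hT i hi).2.2]
        simp [pairCount, hS]
      · intro X hX Y hY h
        exact symmDiff_right_injective u (neighbours_injective (by omega)
          (insert_injective_of_notMem (huN X hX) (huN Y hY) h))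
      · intro i hi j hj hij
        simp only [Function.onFun, Finset.disjoint_left, Finset.mem_image]
        rintro _ ⟨W, hW, rfl⟩ ⟨W', hW', h⟩
        obtain rfl := insert_injective_of_notMem (huT j hj W' hW') (huT i hi W hW) h
        exact hconst i hi W' hW (((hT j hj).2.1 W' hW').2 i (Finset.mem_erase.2 ⟨hij, hi⟩))
      · simp only [Finset.disjoint_left, Finset.mem_biUnion, Finset.mem_image]
        rintro _ ⟨i, hi, W, hW, rfl⟩ ⟨X, hX, h⟩
        obtain rfl := insert_injective_of_notMem (huN X hX) (huT i hi W hW) h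
        exact hconst i hi _ hW (exists_mem_and_exists_notMem_neighbours (by omega) hi)

theorem encard_pull_halfcube {d : ℕ} (hd : 3 ≤ d) {r : (Fin d → ℝ) → (Fin d → ℝ) → Prop}
    (hr : IsPullingOrder r (halfcube d)) : (pull r (halfcube d)).encard = pairCount d := by
  have hmin : ∀ S c : Finset (Fin d), 4 ≤ S.card →
      ∃ v, ∀ w, IsMinVertex r (cubeHull (subhalfcube S c)) w ↔ w = v := by
    intro S c hS
    have hface : IsFace (halfcube d) (cubeHull (subhalfcube S c)) := by
      rw [halfcube_eq_cubeHull, subhalfcube_congr (c' := c) (Finset.subset_univ _)]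
      exact isFace_subhalfcube (Finset.card_pos.1 (by omega)) (Finset.subset_univ _) c
    obtain ⟨v, hv, huniq⟩ := hr.existsUnique_min _ hface
    exact ⟨v, fun w => ⟨huniq w, fun h => h ▸ hv⟩⟩
  obtain ⟨𝒯, h𝒯, -, hcard⟩ :=
    exists_finset_pull_subhalfcube hmin hd Finset.univ ∅ (by simp)
  rw [halfcube_eq_cubeHull, h𝒯, cubeHull_injective.encard_image, Set.encard_coe_eq_coe_finsetCard,
    hcard]

theorem encard_pull_halfcube_of_le_three {d : ℕ} (hd : d ≤ 3)
    (r : (Fin d → ℝ) → (Fin d → ℝ) → Prop) : (pull r (halfcube d)).encard = 1 := by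
  rw [pull_of_isSimplex, Set.encard_singleton]
  rw [halfcube_eq_cubeHull]
  exact isSimplex_cubeHull ⟨∅, by simp [mem_subhalfcube]⟩
    (card_symmDiff_of_mem_subhalfcube (by simpa using hd))

theorem mainTheorem3 :
    ∃ t : ℕ → ℕ,
      (∀ (d : ℕ) (r : (Fin d → ℝ) → (Fin d → ℝ) → Prop), IsPullingOrder r (halfcube d) →
        (pull r (halfcube d)).encard = (t d : ℕ∞)) ∧
      (∀ d : ℕ, d ≤ 3 → t d = 1) ∧
      (∀ d : ℕ, 4 ≤ d → (t d : ℤ) = (d : ℤ) * (t (d - 1) : ℤ) + 2 ^ (d - 1) - (d : ℤ)) ∧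
      (∀ d : ℕ, 3 ≤ d →
        (t d : ℚ) = ∑ l ∈ Finset.Icc 3 d,
          (d.factorial : ℚ) / (l.factorial : ℚ) * (2 ^ (l - 1) - (l : ℚ))) ∧
      (∀ (d : ℕ) (r : (Fin d → ℝ) → (Fin d → ℝ) → Prop), 3 ≤ d →
        IsPullingOrder r (halfcube d) →
        Nonempty (↥(pull r (halfcube d)) ≃ ↥(admissiblePairs d))) := by

  have ht : ∀ d, 3 ≤ d → (if d ≤ 3 then 1 else pairCount d) = pairCount d := by
    intro d hd
    split_ifs with h
    · obtain rfl : d = 3 := by omega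
      rfl
    · rfl
  refine ⟨fun d => if d ≤ 3 then 1 else pairCount d, ?_, ?_, ?_, ?_, ?_⟩
  · intro d r hr
    by_cases hd : d ≤ 3
    · simp only [encard_pull_halfcube_of_le_three hd, if_pos hd, Nat.cast_one]
    · simp only [encard_pull_halfcube (show 3 ≤ d by omega) hr, if_neg hd]
  · intro d hd
    exact if_pos hd
  · intro d hd
    obtain ⟨n, rfl⟩ : ∃ n, d = n + 1 := ⟨d - 1, by omega⟩
    simp only [Nat.add_sub_cancel]
    rw [ht _ (by omega), ht _ (by omega), cast_pairCount_succ]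
    push_cast
    rfl
  · intro d hd
    simp only [ht d hd]
    exact cast_pairCount_eq_sum hd
  · intro d r hd hr
    have h1 := encard_pull_halfcube hd hr
    have h2 := encard_admissiblePairs d
    have := (Set.finite_of_encard_eq_coe h1).to_subtype
    have := (Set.finite_of_encard_eq_coe h2).to_subtype
    rw [← Finite.card_eq]
    rw [Nat.card_coe_set_eq, Nat.card_coe_set_eq, Set.ncard_def, Set.ncard_def, h1, h2]
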